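/- Let $X$ be a locally compact, non-compact Hausdorff space that is connected and locally connected. Call a subset of $X$ bounded if its closure is compact, and solid if it is connected (the empty set counts as connected) and its complement has only unbounded connected components. Let $\mathcal K_s(X)$ be the family of compact solid sets, $\mathcal O_s^*(X)$ the family of bounded open solid sets, and $\mathcal A_s^*(X)=\mathcal K_s(X)\cup\mathcal O_s^*(X)$. A solid set function is a function $\lambda:\mathcal A_s^*(X)\to[0,\infty)$ such that: (s1) $\sum_{i=1}^n\lambda(C_i)\le\lambda(C)$ whenever $C_1,\dots,C_n\in\mathcal K_s(X)$ are pairwise disjoint and contained in $C\in\mathcal K_s(X)$; (s2) $\lambda(U)=\sup\{\lambda(K):K\in\mathcal K_s(X),\,K\subseteq U\}$ for $U\in\mathcal O_s^*(X)$; (s3) $\lambda(K)=\inf\{\lambda(U):U\in\mathcal O_s^*(X),\,K\subseteq U\}$ for $K\in\mathcal K_s(X)$; (s4) $\lambda(A)=\sum_{i=1}^n\lambda(A_i)$ whenever $A\in\mathcal A_s^*(X)$ is the union of pairwise disjoint sets $A_1,\dots,A_n\in\mathcal A_s^*(X)$. A topological measure is a function $\mu$, not identically $\infty$, from the family of all open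 and all closed subsets of $X$ to $[0,\infty]$ such that: (TM1) $\mu(A\cup B)=\mu(A)+\mu(B)$ whenever $A$, $B$ are disjoint and each of $A$, $B$, $A\cup B$ is compact or open; (TM2) $\mu(U)=\sup\{\mu(K):K\text{ compact},\,K\subseteq U\}$ for $U$ open; (TM3) $\mu(F)=\inf\{\mu(U):U\text{ open},\,F\subseteq U\}$ for $F$ closed. Theorem. Let $\lambda$ be a solid set function on $X$ and let $\mu$ be a topological measure on $X$ that extends $\lambda$, i.e. $\mu=\lambda$ on $\mathcal A_s^*(X)$. (a) If $\lambda$ takes only the values $0$ and $1$, then $\mu$ is simple, i.e. takes only the values $0$ and $1$ on open and closed sets. (b) If $\sup\{\lambda(K):K\in\mathcal K_s(X)\}=M<\infty$, then $\mu$ is finite, i.e. $\mu(X)<\infty$, and $\mu(X)=M$. -/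

import Mathlib

open scoped NNReal ENNReal

/-- A set is bounded if its closure is compact. -/
def IsBoundedSet {X : Type*} [TopologicalSpace X] (A : Set X) : Prop :=
  IsCompact (closure A)

/-- A set `A` is solid if it is connected and every connected component of `X \ A` is unbounded.
As usual in this theory the empty set counts as connected, which is why `IsPreconnected` is used;
the components of `X \ A` are the sets `connectedComponentIn Aᶜ x` with `x ∈ Aᶜ`. -/
def IsSolid {X : Type*} [TopologicalSpace X] (A : Set X) : Prop :=
  IsPreconnected A ∧ ∀ x ∈ Aᶜ, ¬ IsBoundedSet (connectedComponentIn Aᶜ x)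

/-- `𝒦ₛ(X)`: the compact solid sets. -/
def compactSolid (X : Type*) [TopologicalSpace X] : Set (Set X) :=
  {A | IsCompact A ∧ IsSolid A}

/-- `𝒪ₛ*(X)`: the bounded open solid sets. -/
def boundedOpenSolid (X : Type*) [TopologicalSpace X] : Set (Set X) :=
  {A | IsOpen A ∧ IsBoundedSet A ∧ IsSolid A}

/-- `𝒜ₛ*(X) = 𝒦ₛ(X) ∪ 𝒪ₛ*(X)`. -/
def boundedSolid (X : Type*) [TopologicalSpace X] : Set (Set X) :=
  compactSolid X ∪ boundedOpenSolid X

/-- Solid set functions `𝒜ₛ*(X) → [0, ∞)`. The function is represented by a total function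
on sets, of which only the values on `𝒜ₛ*(X)` are ever looked at. -/
structure IsSolidSetFunction {X : Type*} [TopologicalSpace X] (lam : Set X → ℝ≥0) : Prop where
  /-- superadditivity on compact solid sets -/
  superadd : ∀ (n : ℕ) (C : Fin n → Set X) (D : Set X),
    (∀ i, C i ∈ compactSolid X) → D ∈ compactSolid X →
    Pairwise (fun i j => Disjoint (C i) (C j)) → (⋃ i, C i) ⊆ D →
    ∑ i, lam (C i) ≤ lam D
  /-- inner regularity on bounded open solid sets -/
  inner_regular : ∀ U ∈ boundedOpenSolid X,
    IsLUB (lam '' {K | K ∈ compactSolid X ∧ K ⊆ U}) (lam U)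
  /-- outer regularity on compact solid sets -/
  outer_regular : ∀ K ∈ compactSolid X,
    IsGLB (lam '' {U | U ∈ boundedOpenSolid X ∧ K ⊆ U}) (lam K)
  /-- additivity on finite solid partitions of a solid set -/
  solid_partition : ∀ (n : ℕ) (B : Fin n → Set X) (A : Set X),
    (∀ i, B i ∈ boundedSolid X) → A ∈ boundedSolid X →
    Pairwise (fun i j => Disjoint (B i) (B j)) → A = ⋃ i, B i →
    lam A = ∑ i, lam (B i)

/-- Topological measures `𝒪(X) ∪ 𝒞(X) → [0, ∞]`. The function is represented by a total function
on sets, of which only the values on open and on closed sets are ever looked at. -/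
structure IsTopologicalMeasure {X : Type*} [TopologicalSpace X] (μ : Set X → ℝ≥0∞) : Prop where
  /-- set functions are not identically `∞` -/
  not_identically_top : ∃ A : Set X, (IsOpen A ∨ IsClosed A) ∧ μ A ≠ ∞
  /-- finite additivity on compact and open sets -/
  additive : ∀ A B : Set X, (IsCompact A ∨ IsOpen A) → (IsCompact B ∨ IsOpen B) →
    (IsCompact (A ∪ B) ∨ IsOpen (A ∪ B)) → Disjoint A B → μ (A ∪ B) = μ A + μ B
  /-- inner regularity on open sets -/
  inner_regular : ∀ U : Set X, IsOpen U →
    μ U = sSup (μ '' {K | IsCompact K ∧ K ⊆ U})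
  /-- outer regularity on closed sets -/
  outer_regular : ∀ F : Set X, IsClosed F →
    μ F = sInf (μ '' {U | IsOpen U ∧ F ⊆ U})

/-- `μ`, a set function on `𝒪(X) ∪ 𝒞(X)`, extends `lam`, a set function on `𝒜ₛ*(X)`. -/
def ExtendsSolid {X : Type*} [TopologicalSpace X] (μ : Set X → ℝ≥0∞) (lam : Set X → ℝ≥0) : Prop :=
  ∀ A ∈ boundedSolid X, μ A = (lam A : ℝ≥0∞)

/-- A set function on `𝒪(X) ∪ 𝒞(X)` is simple if it assumes only the values `0` and `1`. -/
def IsSimpleSetFunction {X : Type*} [TopologicalSpace X] (μ : Set X → ℝ≥0∞) : Prop :=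
  ∀ A : Set X, (IsOpen A ∨ IsClosed A) → μ A = 0 ∨ μ A = 1

/-! Every compact set lies in a compact connected set, and filling the bounded holes of that set
makes it compact solid. Inner regularity on the whole space then gives (b), and in (a) it bounds the
total mass by 1. For (a), a nonempty compact connected `C` splits its hull into `C` and the bounded
components of its complement, which are bounded open solid. Hull and components have mass 0 or 1; so
does the union of the components, since two of mass 1 would exceed the total mass. Subtracting gives
`μ C` = 0 or 1. A compact subset of an open `U` is covered by finitely many disjoint compact
connected subsets of `U`, so `μ U < 1` forces `μ U = 0` by inner regularity; outer regularity
handles closed sets. -/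

open Set Topology

/-! ### Compact connected sets and components of open sets -/

section Topology

variable {X : Type*} [TopologicalSpace X]

theorem IsBoundedSet.subset [T2Space X] {A B : Set X} (hB : IsBoundedSet B) (h : A ⊆ B) :
    IsBoundedSet A :=
  IsCompact.of_isClosed_subset hB isClosed_closure (closure_mono h)

/-- A compact subset of a connected open set lies in a compact connected subset of that set. -/
theorem exists_isCompact_isPreconnected_between [T2Space X] [LocallyCompactSpace X]
    [LocallyConnectedSpace X] {K U : Set X} (hU : IsOpen U) (hUc : IsPreconnected U)
    (hK : IsCompact K) (hKU : K ⊆ U) :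
    ∃ C, IsCompact C ∧ IsPreconnected C ∧ K ⊆ C ∧ C ⊆ U := by
  have nbhd : ∀ x ∈ U, ∃ N ∈ 𝓝 x, IsCompact N ∧ IsPreconnected N ∧ N ⊆ U := by
    intro x hx
    obtain ⟨L, hL, hLU, hLc⟩ := local_compact_nhds (hU.mem_nhds hx)
    obtain ⟨V, hVL, hVo, hxV, hV⟩ := locallyConnectedSpace_iff_subsets_isOpen_isConnected.1
      ‹_› x L hL
    have hcl : closure V ⊆ L := closure_minimal hVL hLc.isClosed
    exact ⟨closure V, Filter.mem_of_superset (hVo.mem_nhds hxV) subset_closure,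
      hLc.of_isClosed_subset isClosed_closure hcl, hV.isPreconnected.closure, hcl.trans hLU⟩
  rcases K.eq_empty_or_nonempty with rfl | ⟨x₀, hx₀⟩
  · exact ⟨∅, isCompact_empty, isPreconnected_empty, subset_rfl, empty_subset _⟩
  have joined : ∀ y ∈ U, ∃ C, IsCompact C ∧ IsPreconnected C ∧ C ⊆ U ∧ x₀ ∈ C ∧ y ∈ C := by
    intro y hy
    -- Lying in a common compact connected subset of `U` is a symmetric, transitive relation that
    -- holds locally, so connectedness of `U` spreads it to all pairs.
    refine hUc.induction₂
      (fun x y => ∃ C, IsCompact C ∧ IsPreconnected C ∧ C ⊆ U ∧ x ∈ C ∧ y ∈ C)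
      ?_ ?_ ?_ (hKU hx₀) hy
    · intro x hx
      obtain ⟨N, hN, hNc, hNp, hNU⟩ := nbhd x hx
      filter_upwards [mem_nhdsWithin_of_mem_nhds hN] with y hy
      exact ⟨N, hNc, hNp, hNU, mem_of_mem_nhds hN, hy⟩
    · rintro x y z - - - ⟨C, hC, hCp, hCU, hx, hy⟩ ⟨D, hD, hDp, hDU, hy', hz⟩
      exact ⟨C ∪ D, hC.union hD, hCp.union y hy hy' hDp, union_subset hCU hDU, .inl hx, .inr hz⟩
    · rintro x y - - ⟨C, hC, hCp, hCU, hx, hy⟩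
      exact ⟨C, hC, hCp, hCU, hy, hx⟩
  -- The common point `x₀` keeps unions connected in the induction over `K`.
  suffices ∃ C, IsCompact C ∧ IsPreconnected C ∧ C ⊆ U ∧ x₀ ∈ C ∧ K ⊆ C by
    obtain ⟨C, h1, h2, h3, -, h5⟩ := this
    exact ⟨C, h1, h2, h5, h3⟩
  refine hK.induction_on (p := fun S => ∃ C, IsCompact C ∧ IsPreconnected C ∧ C ⊆ U ∧ x₀ ∈ C ∧
    S ⊆ C) ?_ ?_ ?_ ?_
  · exact ⟨{x₀}, isCompact_singleton, isPreconnected_singleton,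
      singleton_subset_iff.2 (hKU hx₀), rfl, empty_subset _⟩
  · rintro s t hst ⟨C, h1, h2, h3, h4, h5⟩
    exact ⟨C, h1, h2, h3, h4, hst.trans h5⟩
  · rintro s t ⟨C, h1, h2, h3, h4, h5⟩ ⟨D, k1, k2, k3, k4, k5⟩
    exact ⟨C ∪ D, h1.union k1, h2.union x₀ h4 k4 k2, union_subset h3 k3, .inl h4,
      union_subset_union h5 k5⟩
  · intro y hy
    obtain ⟨C, h1, h2, h3, h4, h5⟩ := joined y (hKU hy)
    obtain ⟨N, hN, hNc, hNp, hNU⟩ := nbhd y (hKU hy)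
    exact ⟨N, mem_nhdsWithin_of_mem_nhds hN, C ∪ N, h1.union hNc,
      h2.union y h5 (mem_of_mem_nhds hN) hNp, union_subset h3 hNU, .inl h4, subset_union_right⟩

/-- A compact subset of an open set `U` meets only finitely many components of `U`. -/
theorem exists_finset_components [LocallyConnectedSpace X] {K U : Set X} (hU : IsOpen U)
    (hK : IsCompact K) (hKU : K ⊆ U) :
    ∃ t : Finset (Set X), (∀ V ∈ t, ∃ x ∈ U, V = connectedComponentIn U x) ∧
      ((t : Set (Set X)).PairwiseDisjoint id) ∧ K ⊆ ⋃ V ∈ t, V := by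
  obtain ⟨t, htU, htf, ht⟩ := hK.elim_finite_subcover_image
    (b := connectedComponentIn U '' U) (c := id)
    (by rintro _ ⟨x, -, rfl⟩; exact hU.connectedComponentIn)
    (fun x hx => mem_biUnion (mem_image_of_mem _ (hKU hx)) (mem_connectedComponentIn (hKU hx)))
  refine ⟨htf.toFinset, ?_, ?_, ?_⟩
  · intro V hV
    obtain ⟨x, hx, rfl⟩ := htU (htf.mem_toFinset.1 hV)
    exact ⟨x, hx, rfl⟩
  · intro V hV W hW hne
    rw [htf.coe_toFinset] at hV hW
    obtain ⟨x, hx, rfl⟩ := htU hV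
    obtain ⟨y, hy, rfl⟩ := htU hW
    by_contra h
    obtain ⟨z, hzx, hzy⟩ := not_disjoint_iff.1 h
    exact hne ((connectedComponentIn_eq hzx).trans (connectedComponentIn_eq hzy).symm)
  · simpa using ht

/-- The trace of a compact subset of an open set on a component of that set is compact. -/
theorem IsCompact.inter_connectedComponentIn [LocallyConnectedSpace X] {K U : Set X}
    (hU : IsOpen U) (hK : IsCompact K) (hKU : K ⊆ U) (x : X) :
    IsCompact (K ∩ connectedComponentIn U x) := by
  -- The rest of `U` is a union of open components; removing it from `K` leaves the trace.
  have hopen : IsOpen (U \ connectedComponentIn U x) := by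
    rw [isOpen_iff_mem_nhds]
    rintro y ⟨hy, hyx⟩
    refine Filter.mem_of_superset
      (hU.connectedComponentIn.mem_nhds (mem_connectedComponentIn hy)) fun z hz => ?_
    refine ⟨connectedComponentIn_subset U y hz, fun hzx => hyx ?_⟩
    rw [connectedComponentIn_eq hzx, ← connectedComponentIn_eq hz]
    exact mem_connectedComponentIn hy
  convert hK.diff hopen using 1
  ext y
  simp only [mem_inter_iff, mem_sdiff, not_and, not_not]
  exact ⟨fun h => ⟨h.1, fun _ => h.2⟩, fun h => ⟨h.1, h.2 (hKU h.1)⟩⟩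

/-- A compact subset of an open set is contained in a finite disjoint union of compact connected
subsets of that set. -/
theorem exists_finset_isCompact_isPreconnected [T2Space X] [LocallyCompactSpace X]
    [LocallyConnectedSpace X] {K U : Set X} (hU : IsOpen U) (hK : IsCompact K) (hKU : K ⊆ U) :
    ∃ (t : Finset (Set X)) (C : Set X → Set X),
      (∀ V ∈ t, IsCompact (C V) ∧ IsPreconnected (C V) ∧ C V ⊆ U) ∧
      ((t : Set (Set X)).PairwiseDisjoint C) ∧ K ⊆ ⋃ V ∈ t, C V := by
  obtain ⟨t, htU, htd, htK⟩ := exists_finset_components hU hK hKU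
  have key : ∀ V ∈ t, ∃ C, IsCompact C ∧ IsPreconnected C ∧ K ∩ V ⊆ C ∧ C ⊆ V := by
    intro V hV
    obtain ⟨x, -, rfl⟩ := htU V hV
    exact exists_isCompact_isPreconnected_between hU.connectedComponentIn
      isPreconnected_connectedComponentIn (hK.inter_connectedComponentIn hU hKU x)
      inter_subset_right
  choose! C hC hCp hKC hCV using key
  refine ⟨t, C, fun V hV => ⟨hC V hV, hCp V hV, ?_⟩, fun V hV W hW hne =>
    (htd hV hW hne).mono (hCV V hV) (hCV W hW), fun x hx => ?_⟩
  · obtain ⟨x, -, rfl⟩ := htU V hV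
    exact (hCV _ hV).trans (connectedComponentIn_subset U x)
  · obtain ⟨V, hV, hxV⟩ := mem_iUnion₂.1 (htK hx)
    exact mem_biUnion hV (hKC V hV ⟨hx, hxV⟩)

/-! ### Components of complements and solid hulls -/

/-- Every component of the complement of a nonempty closed set `C` has a limit point in `C`. -/
theorem exists_mem_closure_connectedComponentIn_compl [ConnectedSpace X]
    [LocallyConnectedSpace X] {C : Set X} (hC : IsClosed C) (hne : C.Nonempty) {x : X}
    (hx : x ∈ Cᶜ) : ∃ z ∈ C, z ∈ closure (connectedComponentIn Cᶜ x) := by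
  by_contra! h
  -- Without a limit point in `C` the component would be clopen, hence all of `X`.
  have hclosed : IsClosed (connectedComponentIn Cᶜ x) := by
    refine isClosed_of_closure_subset fun z hz => ?_
    have hzC : z ∈ Cᶜ := fun hzC => h z hzC hz
    obtain ⟨w, hwz, hwx⟩ := mem_closure_iff.1 hz _ hC.isOpen_compl.connectedComponentIn
      (mem_connectedComponentIn hzC)
    rw [connectedComponentIn_eq hwx, ← connectedComponentIn_eq hwz]
    exact mem_connectedComponentIn hzC
  have huniv := IsClopen.eq_univ ⟨hclosed, hC.isOpen_compl.connectedComponentIn⟩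
    ⟨x, mem_connectedComponentIn hx⟩
  obtain ⟨c, hc⟩ := hne
  exact connectedComponentIn_subset Cᶜ x (huniv ▸ mem_univ c) hc

/-- A connected closed set together with some components of its complement is connected. -/
theorem isPreconnected_of_connectedComponentIn_compl_subset [ConnectedSpace X] [LocallyConnectedSpace X]
    {C A : Set X} (hC : IsClosed C) (hCp : IsPreconnected C) (hne : C.Nonempty) (hCA : C ⊆ A)
    (hA : ∀ x ∈ A, connectedComponentIn Cᶜ x ⊆ A) : IsPreconnected A := by
  obtain ⟨c, hc⟩ := hne
  refine isPreconnected_of_forall c fun y hy => ?_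
  by_cases hyC : y ∈ C
  · exact ⟨C, hCA, hc, hyC, hCp⟩
  obtain ⟨z, hzC, hz⟩ := exists_mem_closure_connectedComponentIn_compl hC ⟨c, hc⟩ hyC
  refine ⟨C ∪ insert z (connectedComponentIn Cᶜ y),
    union_subset hCA (insert_subset (hCA hzC) (hA y hy)), .inl hc,
    .inr (.inr (mem_connectedComponentIn hyC)), ?_⟩
  exact hCp.union z hzC (mem_insert _ _) (isPreconnected_connectedComponentIn.subset_closure
    (subset_insert _ _) (insert_subset hz subset_closure))

/-- The solid hull of `C`: the union of `C` and of the bounded components of its complement. -/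
def solidHull (C : Set X) : Set X :=
  {x | IsBoundedSet (connectedComponentIn Cᶜ x)}

theorem subset_solidHull (C : Set X) : C ⊆ solidHull C := by
  intro x hx
  -- `connectedComponentIn` is empty at points outside its set, so points of `C` pass the
  -- boundedness test.
  have : connectedComponentIn Cᶜ x = ∅ := connectedComponentIn_eq_empty (not_not.2 hx)
  simp [solidHull, IsBoundedSet, this]

theorem connectedComponentIn_subset_solidHull {C : Set X} {x : X} (hx : x ∈ solidHull C) :
    connectedComponentIn Cᶜ x ⊆ solidHull C := by
  intro y hy
  change IsBoundedSet _
  rw [← connectedComponentIn_eq hy]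
  exact hx

theorem isOpen_solidHull_diff [LocallyConnectedSpace X] {C : Set X} (hC : IsClosed C) :
    IsOpen (solidHull C \ C) := by
  rw [isOpen_iff_mem_nhds]
  rintro x ⟨hx, hxC⟩
  refine Filter.mem_of_superset
    (hC.isOpen_compl.connectedComponentIn.mem_nhds (mem_connectedComponentIn hxC)) fun y hy =>
      ⟨connectedComponentIn_subset_solidHull hx hy, connectedComponentIn_subset Cᶜ x hy⟩

theorem isClosed_solidHull [LocallyConnectedSpace X] {C : Set X} (hC : IsClosed C) :
    IsClosed (solidHull C) := by
  rw [← isOpen_compl_iff, isOpen_iff_mem_nhds]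
  intro x hx
  have hxC : x ∈ Cᶜ := fun h => hx (subset_solidHull C h)
  refine Filter.mem_of_superset
    (hC.isOpen_compl.connectedComponentIn.mem_nhds (mem_connectedComponentIn hxC)) fun y hy h => ?_
  apply hx
  change IsBoundedSet _
  rw [connectedComponentIn_eq hy]
  exact h

/-- Take a compact neighbourhood `L` of `C`. A component leaving `L` also accumulates at `C`, so it
crosses `frontier L`, which is compact and misses `C` and so meets only finitely many components.
Hence `L` and finitely many compact closures cover the hull. -/
theorem isCompact_solidHull [T2Space X] [LocallyCompactSpace X] [ConnectedSpace X]
    [LocallyConnectedSpace X] {C : Set X} (hC : IsCompact C) (hne : C.Nonempty) :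
    IsCompact (solidHull C) := by
  obtain ⟨L, hL, hCL⟩ := exists_compact_superset hC
  have hfr : IsCompact (frontier L) :=
    hL.of_isClosed_subset isClosed_frontier hL.isClosed.frontier_subset
  obtain ⟨t, ht, -, hcover⟩ := exists_finset_components hC.isClosed.isOpen_compl hfr
    (fun x hx hxC => hx.2 (hCL hxC))
  classical
  have hcomp : IsCompact (L ∪ ⋃ V ∈ t.filter IsBoundedSet, closure V) :=
    hL.union ((t.filter IsBoundedSet).isCompact_biUnion fun V hV => (Finset.mem_filter.1 hV).2)
  refine hcomp.of_isClosed_subset (isClosed_solidHull hC.isClosed) fun x hx => ?_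
  by_cases hxL : x ∈ L
  · exact .inl hxL
  right
  have hxC : x ∈ Cᶜ := fun h => hxL (interior_subset (hCL h))
  have hxV := mem_connectedComponentIn hxC
  obtain ⟨z, hzC, hz⟩ := exists_mem_closure_connectedComponentIn_compl hC.isClosed hne hxC
  obtain ⟨w, hwL, hw⟩ := mem_closure_iff.1 hz _ isOpen_interior (hCL hzC)
  obtain ⟨p, hpV, hp⟩ : (connectedComponentIn Cᶜ x ∩ frontier L).Nonempty := by
    by_contra h
    obtain ⟨y, -, hyi, hyL⟩ := isPreconnected_connectedComponentIn (interior L) Lᶜ isOpen_interior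
      hL.isClosed.isOpen_compl (fun y hy => or_iff_not_imp_left.2 fun hyi hyL =>
        h ⟨y, hy, subset_closure hyL, hyi⟩) ⟨w, hw, hwL⟩ ⟨x, hxV, hxL⟩
    exact hyL (interior_subset hyi)
  obtain ⟨V, hV, hpV'⟩ := mem_iUnion₂.1 (hcover hp)
  obtain ⟨y, hy, rfl⟩ := ht V hV
  have heq : connectedComponentIn Cᶜ y = connectedComponentIn Cᶜ x :=
    (connectedComponentIn_eq hpV').trans (connectedComponentIn_eq hpV).symm
  refine mem_biUnion (Finset.mem_coe.2 (Finset.mem_filter.2 ⟨hV, ?_⟩))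
    (subset_closure (heq ▸ hxV))
  rw [heq]
  exact hx

theorem solidHull_mem_compactSolid [T2Space X] [LocallyCompactSpace X] [ConnectedSpace X]
    [LocallyConnectedSpace X] {C : Set X} (hC : IsCompact C) (hCp : IsPreconnected C)
    (hne : C.Nonempty) : solidHull C ∈ compactSolid X := by
  refine ⟨isCompact_solidHull hC hne, isPreconnected_of_connectedComponentIn_compl_subset hC.isClosed hCp hne (subset_solidHull C)
    fun x hx => connectedComponentIn_subset_solidHull hx, fun x hx hb => ?_⟩
  have hxC : x ∈ Cᶜ := fun h => hx (subset_solidHull C h)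
  -- The component of `Cᶜ` at `x` avoids the hull, so it lies in the supposedly bounded component of
  -- the hull's complement.
  refine hx (hb.subset (isPreconnected_connectedComponentIn.subset_connectedComponentIn
    (mem_connectedComponentIn hxC) fun y hy h => hx ?_))
  change IsBoundedSet _
  rw [connectedComponentIn_eq hy]
  exact h

/-- Bounded components of the complement of a compact connected set are solid. -/
theorem connectedComponentIn_compl_mem_boundedOpenSolid [T2Space X] [ConnectedSpace X]
    [LocallyConnectedSpace X] [NoncompactSpace X] {C : Set X} (hC : IsCompact C)
    (hCp : IsPreconnected C) (hne : C.Nonempty) {x : X}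
    (hb : IsBoundedSet (connectedComponentIn Cᶜ x)) :
    connectedComponentIn Cᶜ x ∈ boundedOpenSolid X := by
  have hopen : IsOpen (connectedComponentIn Cᶜ x) :=
    hC.isClosed.isOpen_compl.connectedComponentIn
  -- The complement is `C` with the other components attached. Being connected, it is bounded if one
  -- of its components is, and then `X` would be compact.
  have hcompl : IsPreconnected (connectedComponentIn Cᶜ x)ᶜ := by
    refine isPreconnected_of_connectedComponentIn_compl_subset hC.isClosed hCp hne
      (fun y hy h => connectedComponentIn_subset Cᶜ x h hy) fun y hy z hzy hzx => hy ?_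
    rw [connectedComponentIn_eq hzx, ← connectedComponentIn_eq hzy]
    exact mem_connectedComponentIn (connectedComponentIn_nonempty_iff.1 ⟨z, hzy⟩)
  refine ⟨hopen, hb, isPreconnected_connectedComponentIn, fun y hy hby => ?_⟩
  have hbc : IsBoundedSet (connectedComponentIn Cᶜ x)ᶜ :=
    hby.subset (hcompl.subset_connectedComponentIn hy subset_rfl)
  have huniv : IsCompact (closure (connectedComponentIn Cᶜ x) ∪
      closure (connectedComponentIn Cᶜ x)ᶜ) := IsCompact.union hb hbc
  rw [← closure_union, union_compl_self, closure_univ] at huniv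
  exact noncompact_univ X huniv

theorem exists_compactSolid_superset [T2Space X] [LocallyCompactSpace X] [ConnectedSpace X]
    [LocallyConnectedSpace X] {K : Set X} (hK : IsCompact K) : ∃ D ∈ compactSolid X, K ⊆ D := by
  obtain ⟨x⟩ := (inferInstance : Nonempty X)
  -- The added point makes `C` nonempty even if `K` is empty.
  obtain ⟨C, hC, hCp, hKC, -⟩ := exists_isCompact_isPreconnected_between isOpen_univ
    isPreconnected_univ (hK.insert x) (subset_univ _)
  exact ⟨solidHull C, solidHull_mem_compactSolid hC hCp ⟨x, hKC (mem_insert _ _)⟩,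
    (subset_insert x K).trans (hKC.trans (subset_solidHull C))⟩

end Topology

/-! ### Topological measures with values 0 and 1 -/

namespace IsTopologicalMeasure

variable {X : Type*} [TopologicalSpace X] {μ : Set X → ℝ≥0∞}

theorem mono [T2Space X] (hμ : IsTopologicalMeasure μ) {A B : Set X} (hA : IsOpen A ∨ IsClosed A)
    (hB : IsOpen B ∨ IsClosed B) (hAB : A ⊆ B) : μ A ≤ μ B := by
  have open_open : ∀ U V : Set X, IsOpen U → IsOpen V → U ⊆ V → μ U ≤ μ V := by
    intro U V hU hV hUV
    rw [hμ.inner_regular U hU, hμ.inner_regular V hV]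
    exact sSup_le_sSup (image_mono fun K hK => ⟨hK.1, hK.2.trans hUV⟩)
  have of_le_open : (∀ V, IsOpen V → A ⊆ V → μ A ≤ μ V) → μ A ≤ μ B := by
    intro h
    rcases hB with hB | hB
    · exact h B hB hAB
    · rw [hμ.outer_regular B hB]
      refine le_sInf ?_
      rintro _ ⟨V, ⟨hV, hBV⟩, rfl⟩
      exact h V hV (hAB.trans hBV)
  refine of_le_open fun V hV hAV => ?_
  rcases hA with hA | hA
  · exact open_open A V hA hV hAV
  · rw [hμ.outer_regular A hA]
    exact sInf_le ⟨V, ⟨hV, hAV⟩, rfl⟩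

theorem empty [T2Space X] (hμ : IsTopologicalMeasure μ) : μ ∅ = 0 := by
  obtain ⟨A, hA, hAtop⟩ := hμ.not_identically_top
  have hfin : μ ∅ ≠ ∞ := ne_top_of_le_ne_top hAtop
    (hμ.mono (.inl isOpen_empty) hA (empty_subset A))
  -- `μ ∅ = μ ∅ + μ ∅` can be cancelled because `μ ∅` is finite.
  have h := hμ.additive ∅ ∅ (.inr isOpen_empty) (.inr isOpen_empty) (by simp) (by simp)
  rw [union_empty] at h
  exact (ENNReal.add_right_inj hfin).1 (by rw [← h, add_zero])

/-- A finite disjoint union of open sets, or of compact sets, of measure `0` or `1` has measure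
`0` or `1` if the whole space has measure at most `1`. -/
theorem biUnion_eq_zero_or_one [T2Space X] (hμ : IsTopologicalMeasure μ) (huniv : μ univ ≤ 1)
    {ι : Type*} (t : Finset ι) (f : ι → Set X)
    (hf : (∀ i ∈ t, IsCompact (f i)) ∨ ∀ i ∈ t, IsOpen (f i))
    (hd : (t : Set ι).PairwiseDisjoint f) (h01 : ∀ i ∈ t, μ (f i) = 0 ∨ μ (f i) = 1) :
    μ (⋃ i ∈ t, f i) = 0 ∨ μ (⋃ i ∈ t, f i) = 1 := by
  classical
  induction t using Finset.induction_on with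
  | empty => simp [hμ.empty]
  | insert a s ha ih =>
    have hs := ih (hf.imp (fun h i hi => h i (Finset.mem_insert_of_mem hi))
      fun h i hi => h i (Finset.mem_insert_of_mem hi))
      (hd.subset (by simp)) fun i hi => h01 i (Finset.mem_insert_of_mem hi)
    have hregular : (IsCompact (f a) ∧ IsCompact (⋃ i ∈ s, f i)) ∨
        (IsOpen (f a) ∧ IsOpen (⋃ i ∈ s, f i)) :=
      hf.imp (fun h => ⟨h a (Finset.mem_insert_self a s),
          s.isCompact_biUnion fun i hi => h i (Finset.mem_insert_of_mem hi)⟩)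
        fun h => ⟨h a (Finset.mem_insert_self a s),
          isOpen_biUnion fun i hi => h i (Finset.mem_insert_of_mem hi)⟩
    have hunion : IsCompact (f a ∪ ⋃ i ∈ s, f i) ∨ IsOpen (f a ∪ ⋃ i ∈ s, f i) :=
      hregular.imp (fun h => h.1.union h.2) fun h => h.1.union h.2
    have hdisj : Disjoint (f a) (⋃ i ∈ s, f i) := by
      refine disjoint_iUnion₂_right.2 fun i hi => hd (by simp) (by simp [hi]) ?_
      rintro rfl
      exact ha hi
    have hadd := hμ.additive _ _ (hregular.imp (·.1) (·.1)) (hregular.imp (·.2) (·.2)) hunion hdisj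
    have hle := (hμ.mono (hunion.symm.imp id IsCompact.isClosed) (.inl isOpen_univ)
      (subset_univ _)).trans huniv
    rw [Finset.set_biUnion_insert]
    rw [hadd] at hle ⊢
    -- Of the four cases only 1 + 1 is excluded, by the bound on the total mass.
    rcases h01 a (Finset.mem_insert_self a s) with h | h <;> rcases hs with h' | h' <;>
      rw [h, h'] at hle ⊢
    · simp
    · simp
    · simp
    · norm_num at hle

/-- A topological measure bounded by `1` is simple if it takes only the values `0` and `1` on
compact connected sets. -/
theorem isSimple_of_isCompact_isPreconnected [T2Space X] [LocallyCompactSpace X]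
    [LocallyConnectedSpace X] (hμ : IsTopologicalMeasure μ) (huniv : μ univ ≤ 1)
    (h01 : ∀ C : Set X, IsCompact C → IsPreconnected C → μ C = 0 ∨ μ C = 1) :
    IsSimpleSetFunction μ := by
  have le_one : ∀ A : Set X, IsOpen A ∨ IsClosed A → μ A ≤ 1 := fun A hA =>
    (hμ.mono hA (.inl isOpen_univ) (subset_univ _)).trans huniv
  have compact : ∀ K U : Set X, IsCompact K → IsOpen U → K ⊆ U → μ U < 1 → μ K = 0 := by
    intro K U hK hU hKU hlt
    obtain ⟨t, C, hC, hd, hKC⟩ := exists_finset_isCompact_isPreconnected hU hK hKU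
    have hclosed : IsClosed (⋃ V ∈ t, C V) :=
      (t.isCompact_biUnion fun V hV => (hC V hV).1).isClosed
    have hsub : ⋃ V ∈ t, C V ⊆ U := iUnion₂_subset fun V hV => (hC V hV).2.2
    rcases hμ.biUnion_eq_zero_or_one huniv t C (.inl fun V hV => (hC V hV).1) hd
      fun V hV => h01 _ (hC V hV).1 (hC V hV).2.1 with h | h
    · exact le_antisymm (h ▸ hμ.mono (.inr hK.isClosed) (.inr hclosed) hKC) zero_le
    · exact absurd (h ▸ hμ.mono (.inr hclosed) (.inl hU) hsub) (not_le.2 hlt)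
  have opens : ∀ U : Set X, IsOpen U → μ U < 1 → μ U = 0 := by
    intro U hU hlt
    rw [hμ.inner_regular U hU, sSup_eq_bot.2, bot_eq_zero]
    rintro _ ⟨K, ⟨hK, hKU⟩, rfl⟩
    exact compact K U hK hU hKU hlt
  intro A hA
  rcases (le_one A hA).lt_or_eq with hlt | h
  · left
    rcases hA with hA | hA
    · exact opens A hA hlt
    · rw [hμ.outer_regular A hA] at hlt
      obtain ⟨_, ⟨U, ⟨hU, hAU⟩, rfl⟩, hU1⟩ := sInf_lt_iff.1 hlt
      exact le_antisymm (opens U hU hU1 ▸ hμ.mono (.inr hA) (.inl hU) hAU) zero_le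
  · exact .inr h

/-- An open set whose components have measure `0` or `1` has measure `0` or `1`. -/
theorem eq_zero_or_one_of_components [T2Space X] [LocallyConnectedSpace X]
    (hμ : IsTopologicalMeasure μ) (huniv : μ univ ≤ 1) {U W : Set X}
    (hW : IsOpen W) (hWU : W ⊆ U) (hcomp : ∀ x ∈ W, connectedComponentIn U x ⊆ W)
    (h01 : ∀ x ∈ W, μ (connectedComponentIn U x) = 0 ∨ μ (connectedComponentIn U x) = 1) :
    μ W = 0 ∨ μ W = 1 := by
  have hle : μ W ≤ 1 := (hμ.mono (.inl hW) (.inl isOpen_univ) (subset_univ _)).trans huniv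
  refine hle.lt_or_eq.imp_left fun hlt => ?_
  rw [hμ.inner_regular W hW, sSup_eq_bot.2, bot_eq_zero]
  rintro _ ⟨K, ⟨hK, hKW⟩, rfl⟩
  rw [bot_eq_zero]
  -- `W` is a union of components of `U`, so its own components are among these.
  have heq : ∀ x ∈ W, connectedComponentIn W x = connectedComponentIn U x := fun x hx =>
    (connectedComponentIn_mono x hWU).antisymm
      (isPreconnected_connectedComponentIn.subset_connectedComponentIn
        (mem_connectedComponentIn (hWU hx)) (hcomp x hx))
  obtain ⟨t, ht, hd, hKt⟩ := exists_finset_components hW hK hKW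
  have hopen : ∀ V ∈ t, IsOpen V := by
    intro V hV
    obtain ⟨x, -, rfl⟩ := ht V hV
    exact hW.connectedComponentIn
  have hto : IsOpen (⋃ V ∈ t, V) := isOpen_biUnion hopen
  have htW : ⋃ V ∈ t, V ⊆ W := by
    refine iUnion₂_subset fun V hV => ?_
    obtain ⟨x, -, rfl⟩ := ht V hV
    exact connectedComponentIn_subset W x
  rcases hμ.biUnion_eq_zero_or_one huniv t id (.inr hopen) hd fun V hV => by
      obtain ⟨x, hx, rfl⟩ := ht V hV
      simpa only [id, heq x hx] using h01 x hx with h | h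
  · exact le_antisymm (h ▸ hμ.mono (.inr hK.isClosed) (.inl hto) hKt) zero_le
  · exact absurd (h ▸ hμ.mono (.inl hto) (.inl hW) htW) (not_le.2 hlt)

/-- The total mass is the supremum of the masses of the compact solid sets. -/
theorem univ_eq_sSup_compactSolid [T2Space X] [LocallyCompactSpace X] [ConnectedSpace X]
    [LocallyConnectedSpace X] (hμ : IsTopologicalMeasure μ) :
    μ univ = sSup (μ '' compactSolid X) := by
  apply le_antisymm
  · rw [hμ.inner_regular univ isOpen_univ]
    refine sSup_le ?_
    rintro _ ⟨K, ⟨hK, -⟩, rfl⟩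
    obtain ⟨D, hD, hKD⟩ := exists_compactSolid_superset hK
    exact (hμ.mono (.inr hK.isClosed) (.inr hD.1.isClosed) hKD).trans
      (le_sSup (mem_image_of_mem μ hD))
  · refine sSup_le ?_
    rintro _ ⟨D, hD, rfl⟩
    exact hμ.mono (.inr hD.1.isClosed) (.inl isOpen_univ) (subset_univ _)

end IsTopologicalMeasure

/-! ### The main theorem -/

theorem theorem7 {X : Type*} [TopologicalSpace X] [T2Space X] [LocallyCompactSpace X]
    [ConnectedSpace X] [LocallyConnectedSpace X] [NoncompactSpace X]
    (lam : Set X → ℝ≥0) (hlam : IsSolidSetFunction lam)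
    (μ : Set X → ℝ≥0∞) (hμ : IsTopologicalMeasure μ) (hext : ExtendsSolid μ lam) :
    ((∀ A ∈ boundedSolid X, lam A = 0 ∨ lam A = 1) → IsSimpleSetFunction μ) ∧
    (∀ M : ℝ≥0, IsLUB (lam '' compactSolid X) M → μ Set.univ < ∞ ∧ μ Set.univ = (M : ℝ≥0∞)) := by
  constructor
  · intro h01
    have solid01 : ∀ A ∈ boundedSolid X, μ A = 0 ∨ μ A = 1 := fun A hA => by
      rw [hext A hA]
      exact_mod_cast h01 A hA
    have huniv : μ univ ≤ 1 := by
      rw [hμ.univ_eq_sSup_compactSolid]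
      refine sSup_le ?_
      rintro _ ⟨D, hD, rfl⟩
      rcases solid01 D (.inl hD) with h | h <;> simp [h]
    refine hμ.isSimple_of_isCompact_isPreconnected huniv fun C hC hCp => ?_
    rcases C.eq_empty_or_nonempty with rfl | hne
    · exact .inl hμ.empty
    have hhull := solidHull_mem_compactSolid hC hCp hne
    have hopen := isOpen_solidHull_diff hC.isClosed
    have hunion : C ∪ solidHull C \ C = solidHull C := union_sdiff_cancel (subset_solidHull C)
    have hadd := hμ.additive C (solidHull C \ C) (.inl hC) (.inr hopen)
      (.inl (hunion.symm ▸ hhull.1)) disjoint_sdiff_right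
    rw [hunion] at hadd
    have hrest : μ (solidHull C \ C) = 0 ∨ μ (solidHull C \ C) = 1 :=
      hμ.eq_zero_or_one_of_components huniv hopen (fun x hx => hx.2)
        (fun x hx => subset_sdiff.2 ⟨connectedComponentIn_subset_solidHull hx.1,
          disjoint_left.2 fun y hy => connectedComponentIn_subset Cᶜ x hy⟩)
        fun x hx => solid01 _ (.inr
          (connectedComponentIn_compl_mem_boundedOpenSolid hC hCp hne hx.1))
    rcases solid01 _ (.inl hhull) with h | h <;> rw [h] at hadd
    · exact .inl (add_eq_zero.1 hadd.symm).1
    · rcases hrest with h' | h' <;> rw [h'] at hadd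
      · exact .inr (by simpa using hadd.symm)
      -- Here 1 = `μ C` + 1, and the finite summand cancels.
      · refine .inl ((ENNReal.add_left_inj ENNReal.one_ne_top).1 ?_)
        rw [← hadd, zero_add]
  · intro M hM
    have huniv : μ univ = (M : ℝ≥0∞) := by
      rw [hμ.univ_eq_sSup_compactSolid]
      apply le_antisymm
      · refine sSup_le ?_
        rintro _ ⟨D, hD, rfl⟩
        rw [hext D (.inl hD)]
        exact_mod_cast hM.1 (mem_image_of_mem lam hD)
      · refine le_of_forall_lt fun c hc => ?_
        lift c to ℝ≥0 using hc.ne_top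
        obtain ⟨_, ⟨D, hD, rfl⟩, hcD, -⟩ := hM.exists_between (ENNReal.coe_lt_coe.1 hc)
        refine lt_of_lt_of_le (ENNReal.coe_lt_coe.2 hcD) ?_
        rw [← hext D (.inl hD)]
        exact le_sSup (mem_image_of_mem μ hD)
    exact ⟨huniv ▸ ENNReal.coe_lt_top, huniv⟩
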